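/- Let $n\ge 2$, let $\Sigma=\{x\in\mathbb{R}_{\ge 0}^n : \sum_i x_i=1\}$, and let $C$ be an $n\times n$ real matrix all of whose entries are positive. For every $T>0$ let $g_T:[0,1]\to\mathbb{R}_{>0}$ be a continuously differentiable increasing map with $g_T(0)=1$ and $g_T'(x)>0$ for all $x\in[0,1]$, and suppose that $$\lim_{T\to 0^+}\ \min_{x\in[0,1]}\frac{g_T'(x)}{g_T(x)}=\infty,\qquad \lim_{T\to\infty}\ \max_{x\in[0,1]}\frac{g_T'(x)}{g_T(x)}=0 .$$ For $T>0$ and $x\in\Sigma$ let $M_T(x)$ be the stochastic matrix with entries $$M_T(x)_{ij}=\frac{C_{ij}\,g_T(x_j)}{\sum_k C_{ik}\,g_T(x_k)},$$ and let $u_T(x)\in\Sigma$ be its unique invariant measure, that is, the unique $u\in\Sigma$ with $u\,M_T(x)=u$. Then: 1. For all sufficiently small $T>0$ the map $u_T$ has several (at least two) fixed points in $\Sigma$. 2. These lie near different vertices of the simplex: for every $0<\varepsilon<\tfrac12$ there exists $T_\varepsilon>0$ such that, for every $0<T\le T_\varepsilon$ and every index $r\in\{1,\dots,n\}$, the map $u_T$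 has a fixed point $x\in\Sigma$ with $x_r\ge 1-\varepsilon$. (As $\varepsilon<\tfrac12$, fixed points belonging to different indices $r$ are different.) -/

import Mathlib

open Filter Topology Set
open scoped Matrix

/-- `min_{x ∈ [0,1]} g'(x) / g(x)` (attained when `g` is positive and `C¹` on `[0,1]`). -/
noncomputable def lipMin (g : ℝ → ℝ) : ℝ :=
  sInf ((fun x => derivWithin g (Icc 0 1) x / g x) '' Icc 0 1)

/-- `max_{x ∈ [0,1]} g'(x) / g(x)` (attained when `g` is positive and `C¹` on `[0,1]`). -/
noncomputable def lipMax (g : ℝ → ℝ) : ℝ :=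
  sSup ((fun x => derivWithin g (Icc 0 1) x / g x) '' Icc 0 1)

/-- The standing hypotheses on a family of maps `g T : [0,1] → ℝ_{>0}`, indexed by the
temperature `T > 0`.  Values of `g T` for `T ≤ 0` or outside `[0,1]` play no role. -/
structure IsTemperatureFamily (g : ℝ → ℝ → ℝ) : Prop where
  pos : ∀ T, 0 < T → ∀ x ∈ Icc (0 : ℝ) 1, 0 < g T x
  contDiffOn : ∀ T, 0 < T → ContDiffOn ℝ 1 (g T) (Icc 0 1)
  map_zero : ∀ T, 0 < T → g T 0 = 1
  strictMonoOn : ∀ T, 0 < T → StrictMonoOn (g T) (Icc 0 1)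
  deriv_pos : ∀ T, 0 < T → ∀ x ∈ Icc (0 : ℝ) 1, 0 < derivWithin (g T) (Icc 0 1) x
  tendsto_lipMin : Tendsto (fun T => lipMin (g T)) (𝓝[>] 0) atTop
  tendsto_lipMax : Tendsto (fun T => lipMax (g T)) atTop (𝓝 0)

/-- The transition matrix `M_T(x)_{ij} = C_{ij} g_T(x_j) / ∑_k C_{ik} g_T(x_k)`. -/
noncomputable def transitionMatrix {n : ℕ} (C : Matrix (Fin n) (Fin n) ℝ) (g : ℝ → ℝ → ℝ)
    (T : ℝ) (x : Fin n → ℝ) : Matrix (Fin n) (Fin n) ℝ :=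
  Matrix.of fun i j => C i j * g T (x j) / ∑ k, C i k * g T (x k)

/-- A stochastic row vector `u` is an invariant measure of `A` if `u A = u`. -/
def IsInvariantMeasure {n : ℕ} (A : Matrix (Fin n) (Fin n) ℝ) (u : Fin n → ℝ) : Prop :=
  u ∈ stdSimplex ℝ (Fin n) ∧ u ᵥ* A = u

open scoped Classical in
/-- The unique invariant measure of `A`.  If `A` does not have exactly one invariant measure,
the value is `0`, which is not a point of the simplex (so that it cannot produce a fixed point
in the simplex). -/
noncomputable def invariantMeasure {n : ℕ} (A : Matrix (Fin n) (Fin n) ℝ) : Fin n → ℝ :=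
  if h : ∃! u, IsInvariantMeasure A u then h.choose else 0

/-- The map `u_T`, sending `x` to the unique invariant measure of `M_T(x)`. -/
noncomputable def uMap {n : ℕ} (C : Matrix (Fin n) (Fin n) ℝ) (g : ℝ → ℝ → ℝ) (T : ℝ)
    (x : Fin n → ℝ) : Fin n → ℝ :=
  invariantMeasure (transitionMatrix C g T x)

/-!
A point `x` of the simplex with `x M_T(x) = x` is a fixed point of `u_T`, because a positive
stochastic matrix has only one invariant measure (`invariantMeasure_eq_of_pos`). It therefore
suffices to find fixed points of the explicit continuous map `x ↦ x M_T(x)`, and no continuity of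
`u_T` is needed.

On the part of the simplex where `1 - ε ≤ x r`, the other coordinates are at most `ε`. Integrating
`g_T' / g_T ≥ lipMin (g T)` shows that, for `k ≠ r`, `g_T(x_k) / g_T(x_r)` is exponentially
small in `lipMin (g T)`, and the latter tends to infinity as `T → 0`. For small `T`, each row of
`M_T(x)` thus puts mass at least `1 - ε` on `r` (`one_sub_le_transitionMatrix`), and so does `x M_T(x)`.
Brouwer's theorem on this compact convex set gives a fixed point near the vertex `r`; for `ε < 1/2`
those near different vertices are different.

Brouwer's theorem is proved by the argument of Milnor and Rogers. For a `C¹` retraction `r` of the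
ball onto the sphere, the integral over the ball of the Jacobian of `x ↦ (1 - t) x + t r(x)` is a
polynomial in `t`. It is the volume of the ball for small `t`, where the map is a diffeomorphism of
the ball, and zero at `t = 1`, where `‖r‖² = 1` makes the derivative singular. This excludes such
retractions, hence `C¹` maps of the ball without fixed points; smooth approximation and the
nearest-point projection extend this to continuous maps of compact convex sets.
-/

/-! ### Determinants of affine families of linear maps -/

open MeasureTheory Metric in
/-- The integral of `det (1 + t A(x))` is a polynomial function of `t`: the determinant is expanded
over the ring of functions that are continuous on `s`, and its coefficients are integrated. -/
theorem exists_polynomial_eval_eq_setIntegral_det {E : Type*} [NormedAddCommGroup E]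
    [NormedSpace ℝ E] [FiniteDimensional ℝ E] [MeasurableSpace E] [BorelSpace E]
    (μ : Measure E) [IsFiniteMeasureOnCompacts μ] {A : E → E →L[ℝ] E} {s u : Set E}
    (hA : ContinuousOn A s) (hs : IsCompact s) (hus : u ⊆ s) :
    ∃ p : Polynomial ℝ, ∀ t : ℝ, p.eval t = ∫ x in u, (1 + t • A x).det ∂μ := by
  classical
  let b := Module.finBasis ℝ E
  let R : Subring (E → ℝ) :=
    { carrier := {f | ContinuousOn f s}
      mul_mem' := fun hf hg => hf.mul hg
      one_mem' := continuousOn_const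
      add_mem' := fun hf hg => hf.add hg
      zero_mem' := continuousOn_const
      neg_mem' := fun hf => hf.neg }
  have hm : ∀ i j, (fun x => LinearMap.toMatrix b b (A x : E →ₗ[ℝ] E) i j) ∈ R := by
    intro i j
    have h1 : ContinuousOn (fun x => b.coord i (A x (b j))) s :=
      (LinearMap.continuous_of_finiteDimensional (b.coord i)).comp_continuousOn
        (hA.clm_apply continuousOn_const)
    exact h1.congr fun x _ => by simp [LinearMap.toMatrix_apply]
  let m : Matrix (Fin (Module.finrank ℝ E)) (Fin (Module.finrank ℝ E)) R :=
    Matrix.of fun i j => ⟨_, hm i j⟩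
  let q : Polynomial R := Matrix.det (1 + (Polynomial.X : Polynomial R) • m.map Polynomial.C)
  have hint : ∀ k, IntegrableOn (q.coeff k : E → ℝ) u μ := fun k =>
    ((q.coeff k).2.integrableOn_compact hs).mono_set hus
  have hq : ∀ t x, ∑ k ∈ Finset.range (q.natDegree + 1), (q.coeff k : E → ℝ) x * t ^ k
      = (1 + t • A x).det := by
    intro t x
    let φ : Polynomial R →+* ℝ :=
      Polynomial.eval₂RingHom ((Pi.evalRingHom (fun _ : E => ℝ) x).comp R.subtype) t
    have h1 : φ q = ∑ k ∈ Finset.range (q.natDegree + 1), (q.coeff k : E → ℝ) x * t ^ k := by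
      simp [φ, Polynomial.eval₂_eq_sum_range]
    rw [← h1, RingHom.map_det]
    have h2 : (1 + t • A x).det = LinearMap.det (1 + t • (A x : E →ₗ[ℝ] E)) := rfl
    rw [h2, ← LinearMap.det_toMatrix b]
    congr 1
    ext i j
    simp [φ, m, Matrix.one_apply, apply_ite, LinearMap.toMatrix_one]
    exact mul_comm _ _
  refine ⟨∑ k ∈ Finset.range (q.natDegree + 1),
    Polynomial.C (∫ x in u, (q.coeff k : E → ℝ) x ∂μ) * Polynomial.X ^ k, fun t => ?_⟩
  simp_rw [← hq t]
  rw [integral_finsetSum _ fun k _ => (hint k).mul_const _]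
  simp [Polynomial.eval_finsetSum, integral_mul_const]

/-! ### Brouwer's fixed point theorem -/

section Ball

open MeasureTheory Metric

variable {E : Type*} [NormedAddCommGroup E] [NormedSpace ℝ E] [FiniteDimensional ℝ E]

/-- For small `t ≥ 0`, a perturbation `x ↦ x + t • h x` that fixes the unit sphere is a
diffeomorphism of the open unit ball onto itself, so its Jacobian integrates to the volume of
the ball. -/
theorem setIntegral_det_one_add_smul_fderiv_eq [MeasurableSpace E] [BorelSpace E]
    (μ : Measure E) [μ.IsAddHaarMeasure] {h : E → E} {U : Set E} (hU : IsOpen U)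
    (hBU : closedBall (0 : E) 1 ⊆ U) (hh : ContDiffOn ℝ 1 h U)
    (hmaps : ∀ x ∈ closedBall (0 : E) 1, ‖x + h x‖ ≤ 1)
    (hsphere : ∀ x, ‖x‖ = 1 → h x = 0) {K : NNReal}
    (hK : LipschitzOnWith K h (closedBall 0 1)) {t : ℝ} (ht0 : 0 ≤ t) (ht1 : t < 1)
    (htK : t * K < 1) :
    ∫ x in ball (0 : E) 1, (1 + t • fderiv ℝ h x).det ∂μ = μ.real (ball 0 1) := by
  set φ : E → E := fun x => x + t • h x with hφ
  have hnhds : ∀ x ∈ ball (0 : E) 1, closedBall (0 : E) 1 ∈ 𝓝 x := fun x hx =>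
    mem_of_superset (isOpen_ball.mem_nhds hx) ball_subset_closedBall
  have hnorm : ∀ x ∈ ball (0 : E) 1, ‖fderiv ℝ h x‖ ≤ K := fun x hx =>
    norm_fderiv_le_of_lipschitzOn ℝ (hnhds x hx) hK
  have hstrict : ∀ x ∈ ball (0 : E) 1, HasStrictFDerivAt φ (1 + t • fderiv ℝ h x) x := by
    intro x hx
    have h1 : ContDiffAt ℝ 1 h x := hh.contDiffAt (hU.mem_nhds (hBU (ball_subset_closedBall hx)))
    exact (hasStrictFDerivAt_id x).add ((h1.hasStrictFDerivAt (by norm_num)).const_smul t)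
  have hdet_ne : ∀ x ∈ ball (0 : E) 1, ∀ a ∈ Icc (0 : ℝ) t, (1 + a • fderiv ℝ h x).det ≠ 0 := by
    intro x hx a ha
    have h1 : ‖-(a • fderiv ℝ h x)‖ < 1 := by
      rw [norm_neg, norm_smul, Real.norm_of_nonneg ha.1]
      calc a * ‖fderiv ℝ h x‖ ≤ t * K :=
            mul_le_mul ha.2 (hnorm x hx) (norm_nonneg _) ht0
        _ < 1 := htK
    have h2 := isUnit_one_sub_of_norm_lt_one h1
    rw [sub_neg_eq_add] at h2
    have h3 : IsUnit (((1 + a • fderiv ℝ h x : E →L[ℝ] E)) : E →ₗ[ℝ] E) :=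
      h2.map (ContinuousLinearMap.toLinearMapRingHom (R₁ := ℝ) (M₁ := E))
    exact (h3.map (LinearMap.det (M := E) (A := ℝ))).ne_zero
  -- the determinant is `1` at `a = 0` and has no zero for `a ∈ [0, t]`
  have hdet : ∀ x ∈ ball (0 : E) 1, 0 < (1 + t • fderiv ℝ h x).det := by
    intro x hx
    by_contra hneg
    have hcont : ContinuousOn (fun a : ℝ => (1 + a • fderiv ℝ h x).det) (Icc 0 t) :=
      (ContinuousLinearMap.continuous_det.comp (by fun_prop)).continuousOn
    obtain ⟨a, ha, ha0⟩ := intermediate_value_Icc' ht0 hcont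
      (show (0 : ℝ) ∈ Icc _ _ from ⟨not_lt.1 hneg, by simp [ContinuousLinearMap.det]⟩)
    exact hdet_ne x hx a ha ha0
  have hinj : InjOn φ (ball 0 1) := by
    intro x hx y hy hxy
    have h1 : x - y = t • (h y - h x) := by
      rw [smul_sub, sub_eq_sub_iff_add_eq_add]
      simpa [hφ, add_comm] using hxy
    have h2 := hK.dist_le_mul y (ball_subset_closedBall hy) x (ball_subset_closedBall hx)
    rw [dist_eq_norm, dist_comm, dist_eq_norm] at h2
    have h3 : ‖x - y‖ ≤ t * K * ‖x - y‖ := by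
      calc ‖x - y‖ = t * ‖h y - h x‖ := by
            rw [h1, norm_smul, Real.norm_of_nonneg ht0]
        _ ≤ t * (K * ‖x - y‖) := by gcongr
        _ = _ := by ring
    have h4 : ‖x - y‖ ≤ 0 := by nlinarith [norm_nonneg (x - y)]
    exact sub_eq_zero.1 (norm_le_zero_iff.1 h4)
  have hopen : IsOpen (φ '' ball 0 1) := by
    rw [isOpen_iff_mem_nhds]
    rintro _ ⟨x, hx, rfl⟩
    have h1 : HasStrictFDerivAt φ
        ((ContinuousLinearMap.toContinuousLinearEquivOfDetNeZero _ (hdet x hx).ne' :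
          E ≃L[ℝ] E) : E →L[ℝ] E) x := by
      simpa using hstrict x hx
    rw [← h1.map_nhds_eq_of_equiv]
    exact image_mem_map (isOpen_ball.mem_nhds hx)
  have hφball : φ '' ball 0 1 ⊆ ball 0 1 := by
    rintro _ ⟨x, hx, rfl⟩
    have h1 : φ x = (1 - t) • x + t • (x + h x) := by simp only [hφ]; module
    rw [mem_ball_zero_iff, h1]
    have hx' : ‖x‖ < 1 := mem_ball_zero_iff.1 hx
    calc ‖(1 - t) • x + t • (x + h x)‖ ≤ (1 - t) * ‖x‖ + t * ‖x + h x‖ := by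
          refine (norm_add_le _ _).trans_eq ?_
          rw [norm_smul, norm_smul, Real.norm_of_nonneg ht0, Real.norm_of_nonneg (by linarith)]
      _ < 1 := by nlinarith [hmaps x (ball_subset_closedBall hx)]
  -- the image of the ball is open, and relatively closed in the ball because sphere points are fixed
  have himage : φ '' ball 0 1 = ball 0 1 := by
    refine hφball.antisymm ?_
    have hcpt : IsCompact (φ '' closedBall 0 1) :=
      (isCompact_closedBall (0 : E) 1).image_of_continuousOn
        (continuousOn_id.add ((hh.continuousOn.mono hBU).const_smul t))
    refine (convex_ball (0 : E) 1).isPreconnected.subset_of_closure_inter_subset hopen ?_ ?_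
    · exact ⟨φ 0, hφball ⟨0, by simp, rfl⟩, 0, by simp, rfl⟩
    · rintro y ⟨hy, hyB⟩
      obtain ⟨x, hx, rfl⟩ := closure_minimal (image_mono ball_subset_closedBall)
        hcpt.isClosed hy
      rcases (mem_closedBall_zero_iff.1 hx).lt_or_eq with hlt | heq
      · exact ⟨x, mem_ball_zero_iff.2 hlt, rfl⟩
      · have h1 : φ x = x := by simp [hφ, hsphere x heq]
        rw [h1, mem_ball_zero_iff] at hyB
        exact absurd heq hyB.ne
  have hcv := integral_image_eq_integral_abs_det_fderiv_smul μ
    (measurableSet_ball : MeasurableSet (ball (0 : E) 1))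
    (fun x hx => (hstrict x hx).hasFDerivAt.hasFDerivWithinAt) hinj (fun _ => (1 : ℝ))
  rw [himage] at hcv
  simp only [integral_const, smul_eq_mul, mul_one, measureReal_restrict_apply_univ] at hcv
  rw [hcv]
  exact setIntegral_congr_fun measurableSet_ball fun x hx => (abs_of_pos (hdet x hx)).symm

end Ball

section Inner

open MeasureTheory Metric

variable {E : Type*} [NormedAddCommGroup E] [InnerProductSpace ℝ E] [FiniteDimensional ℝ E]

/-- There is no `C¹` retraction `r` of the closed unit ball onto its sphere. The integral over the
ball of the Jacobian of `x ↦ (1 - t) x + t r x` is a polynomial in `t`. It equals the volume of the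
ball for small `t > 0`, hence for all `t`; but at `t = 1` the Jacobian vanishes. -/
theorem not_exists_contDiffOn_retraction_sphere {r : E → E} {U : Set E} (hU : IsOpen U)
    (hBU : closedBall (0 : E) 1 ⊆ U) (hr : ContDiffOn ℝ 1 r U)
    (hnorm : ∀ x ∈ closedBall (0 : E) 1, ‖r x‖ = 1) (hfix : ∀ x, ‖x‖ = 1 → r x = x) :
    False := by
  borelize E
  set h : E → E := fun x => r x - x with hh_def
  have hh : ContDiffOn ℝ 1 h U := hr.sub contDiffOn_id
  obtain ⟨K, hK⟩ := (hh.mono hBU).exists_lipschitzOnWith one_ne_zero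
    (convex_closedBall (0 : E) 1) (isCompact_closedBall 0 1)
  obtain ⟨p, hp⟩ := exists_polynomial_eval_eq_setIntegral_det (volume : Measure E)
    ((hh.continuousOn_fderiv_of_isOpen hU le_rfl).mono hBU) (isCompact_closedBall 0 1)
    ball_subset_closedBall
  have hsmall : ∀ t ∈ Ioo (0 : ℝ) (1 / (K + 1)), p.eval t = volume.real (ball (0 : E) 1) := by
    intro t ht
    have hK0 : (0 : ℝ) ≤ K := K.2
    have h1 : t * (K + 1) < 1 := (lt_div_iff₀ (by positivity)).1 ht.2
    rw [hp]
    refine setIntegral_det_one_add_smul_fderiv_eq volume hU hBU hh ?_ ?_ hK ht.1.le ?_ ?_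
    · intro x hx
      simp [hh_def, hnorm x hx]
    · intro x hx
      simp [hh_def, hfix x hx]
    · nlinarith [mul_nonneg ht.1.le hK0]
    · nlinarith [ht.1]
  have hpconst : p = Polynomial.C (volume.real (ball (0 : E) 1)) := by
    have hK : (0 : ℝ) < 1 / (K + 1) := one_div_pos.2 (add_pos_of_nonneg_of_pos K.2 one_pos)
    refine Polynomial.eq_of_infinite_eval_eq _ _ ((Ioo_infinite hK).mono fun t ht => ?_)
    simpa using hsmall t ht
  have hone : p.eval 1 = 0 := by
    rw [hp]
    refine setIntegral_eq_zero_of_forall_eq_zero fun x hx => ?_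
    have hxU : U ∈ 𝓝 x := hU.mem_nhds (hBU (ball_subset_closedBall hx))
    have hd : HasFDerivAt r (fderiv ℝ r x) x :=
      ((hr.contDiffAt hxU).differentiableAt one_ne_zero).hasFDerivAt
    have h1 : fderiv ℝ h x = fderiv ℝ r x - 1 := (hd.sub (hasFDerivAt_id x)).fderiv
    rw [h1, one_smul, add_sub_cancel]
    -- `‖r‖² = 1` near `x`, hence the image of the derivative is orthogonal to `r x ≠ 0`
    have h2 : ∀ v, inner ℝ (r x) (fderiv ℝ r x v) = 0 := by
      intro v
      have h3 := (hd.inner ℝ hd)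
      have h4 : (fun y => inner ℝ (r y) (r y)) =ᶠ[𝓝 x] fun _ => (1 : ℝ) := by
        filter_upwards [isOpen_ball.mem_nhds hx] with y hy
        rw [real_inner_self_eq_norm_sq, hnorm y (ball_subset_closedBall hy), one_pow]
      have h5 := h3.unique ((hasFDerivAt_const (1 : ℝ) x).congr_of_eventuallyEq h4)
      have h6 := congrArg (fun L => L v) h5
      simp [fderivInnerCLM_apply, real_inner_comm] at h6
      linarith
    by_contra hne
    have hsurj := (ContinuousLinearMap.toContinuousLinearEquivOfDetNeZero _ hne).surjective (r x)
    obtain ⟨v, hv⟩ := hsurj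
    have h7 := h2 v
    have hv' : fderiv ℝ r x v = r x := by simpa using hv
    rw [hv', real_inner_self_eq_norm_sq, hnorm x (ball_subset_closedBall hx)] at h7
    norm_num at h7
  rw [hpconst, Polynomial.eval_C] at hone
  have hpos : 0 < volume.real (ball (0 : E) 1) :=
    ENNReal.toReal_pos (measure_ball_pos _ _ one_pos).ne' measure_ball_lt_top.ne
  exact hpos.ne' hone

/-- Brouwer's theorem for `C¹` maps into the unit ball. Without a fixed point, sending `x` to the
point where the ray from `F x` through `x` leaves the ball would be a `C¹` retraction onto the
sphere. -/
theorem exists_fixedPoint_of_contDiff {F : E → E} (hF : ContDiff ℝ 1 F) (hF1 : ∀ x, ‖F x‖ ≤ 1) :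
    ∃ x ∈ closedBall (0 : E) 1, F x = x := by
  by_contra! hne
  set u : E → E := fun x => x - F x with hu
  -- `lam x` is the larger root `l` of `‖x + l • u x‖ = 1`, with discriminant `4 * D x`
  set D : E → ℝ := fun x => inner ℝ x (u x) ^ 2 + ‖u x‖ ^ 2 * (1 - ‖x‖ ^ 2) with hD
  set lam : E → ℝ := fun x => (-inner ℝ x (u x) + √(D x)) / ‖u x‖ ^ 2 with hlam
  have huc : ContDiff ℝ 1 u := contDiff_id.sub hF
  have hDc : ContDiff ℝ 1 D :=
    ((contDiff_id.inner ℝ huc).pow 2).add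
      ((huc.norm_sq ℝ).mul (contDiff_const.sub (contDiff_id.norm_sq ℝ)))
  have hu0 : ∀ x ∈ closedBall (0 : E) 1, 0 < ‖u x‖ ^ 2 := fun x hx =>
    pow_pos (norm_pos_iff.2 (sub_ne_zero.2 (hne x hx).symm)) 2
  have hinner : ∀ x, ‖x‖ = 1 → 0 < inner ℝ x (u x) := by
    intro x hx
    have h1 := hu0 x (by simp [hx])
    have h2 : ‖F x‖ ^ 2 = ‖x‖ ^ 2 - 2 * inner ℝ x (u x) + ‖u x‖ ^ 2 := by
      rw [← norm_sub_sq_real]; simp [hu]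
    have h3 := hF1 x
    rw [hx] at h2
    nlinarith [norm_nonneg (F x)]
  have hD0 : ∀ x ∈ closedBall (0 : E) 1, 0 < D x := by
    intro x hx
    rcases (mem_closedBall_zero_iff.1 hx).lt_or_eq with hlt | heq
    · have h1 : 0 < 1 - ‖x‖ ^ 2 := by nlinarith [norm_nonneg x]
      have := mul_pos (hu0 x hx) h1
      simp only [hD]; positivity
    · have := hinner x heq
      simp only [hD, heq]; simp; positivity
  have hUopen : IsOpen {x | 0 < D x ∧ 0 < ‖u x‖ ^ 2} :=
    (isOpen_lt continuous_const hDc.continuous).inter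
      (isOpen_lt continuous_const (huc.continuous.norm.pow 2))
  refine not_exists_contDiffOn_retraction_sphere (r := fun x => x + lam x • u x) hUopen
    (fun x hx => ⟨hD0 x hx, hu0 x hx⟩) ?_ ?_ ?_
  · refine contDiffOn_id.add (ContDiffOn.smul (ContDiffOn.div ?_ ?_ ?_) huc.contDiffOn)
    · exact (contDiff_id.inner ℝ huc).neg.contDiffOn.add
        (hDc.contDiffOn.sqrt fun x hx => hx.1.ne')
    · exact (huc.norm_sq ℝ).contDiffOn
    · exact fun x hx => hx.2.ne'
  · intro x hx
    have h1 : ‖x + lam x • u x‖ ^ 2 = 1 := by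
      rw [norm_add_sq_real, inner_smul_right, norm_smul, mul_pow, Real.norm_eq_abs, sq_abs]
      have h2 := Real.sq_sqrt (hD0 x hx).le
      have h3 : lam x * ‖u x‖ ^ 2 = -inner ℝ x (u x) + √(D x) := by
        simp only [hlam]
        exact div_mul_cancel₀ _ (hu0 x hx).ne'
      have h4 : D x = inner ℝ x (u x) ^ 2 + ‖u x‖ ^ 2 * (1 - ‖x‖ ^ 2) := rfl
      -- clearing the denominator of `lam x` leaves a polynomial identity
      refine mul_left_cancel₀ (hu0 x hx).ne' ?_
      generalize lam x = l at *
      generalize √(D x) = w at *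
      generalize inner ℝ x (u x) = a at *
      generalize ‖u x‖ ^ 2 = c at *
      rw [h4] at h2
      linear_combination (l * c + a + w) * h3 + h2
    nlinarith [norm_nonneg (x + lam x • u x)]
  · intro x hx
    have h1 : lam x = 0 := by
      simp [hlam, hD, hx, Real.sqrt_sq (hinner x hx).le]
    simp [h1]

/-- Brouwer's theorem for continuous maps into the unit ball. A map without fixed points moves every
point of the ball by at least some `δ > 0`, so a smooth `δ`-approximation has none either. -/
theorem exists_fixedPoint_of_continuous_of_norm_le_one {f : E → E} (hf : Continuous f)
    (hf1 : ∀ x, ‖f x‖ ≤ 1) : ∃ x, f x = x := by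
  by_contra! hne
  obtain ⟨z, -, hz⟩ := (isCompact_closedBall (0 : E) 1).exists_isMinOn ⟨0, by simp⟩
    (continuous_id.sub hf).norm.continuousOn
  have hδ : 0 < ‖z - f z‖ := norm_pos_iff.2 (sub_ne_zero.2 (hne z).symm)
  obtain ⟨F, hF⟩ := exists_contMDiffMap_forall_mem_convex_of_local_const
    (modelWithCornersSelf ℝ E) (n := 1)
    (t := fun x => ball (f x) ‖z - f z‖ ∩ closedBall (0 : E) 1)
    (fun x => (convex_ball _ _).inter (convex_closedBall _ _))
    (fun x => ⟨f x, by
      filter_upwards [hf.continuousAt.preimage_mem_nhds (ball_mem_nhds (f x) hδ)] with y hy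
      exact ⟨by rw [mem_ball_comm]; exact hy, by simpa using hf1 x⟩⟩)
  obtain ⟨x, hx, hFx⟩ := exists_fixedPoint_of_contDiff (F := F) F.contMDiff.contDiff
    (fun x => by simpa using (hF x).2)
  have h1 := (hF x).1
  rw [hFx, mem_ball, dist_eq_norm] at h1
  exact absurd h1 (not_lt.2 (hz hx))

/-- The nearest-point projection onto a nonempty closed convex set is a nonexpansive retraction. -/
theorem exists_lipschitzWith_retraction_of_convex {K : Set E} (hne : K.Nonempty)
    (hK : IsClosed K) (hc : Convex ℝ K) :
    ∃ π : E → E, LipschitzWith 1 π ∧ (∀ x, π x ∈ K) ∧ ∀ x ∈ K, π x = x := by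
  choose π hπK hπ using exists_norm_eq_iInf_of_complete_convex hne hK.isComplete hc
  have hin : ∀ x, ∀ w ∈ K, inner ℝ (x - π x) (w - π x) ≤ 0 := fun x =>
    (norm_eq_iInf_iff_real_inner_le_zero hc (hπK x)).1 (hπ x)
  refine ⟨π, LipschitzWith.of_dist_le_mul fun x y => ?_, hπK, fun x hx => ?_⟩
  · have h1 := hin x (π y) (hπK y)
    have h2 := hin y (π x) (hπK x)
    have h3 : ‖π x - π y‖ ^ 2 ≤ inner ℝ (x - y) (π x - π y) := by
      rw [← real_inner_self_eq_norm_sq]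
      simp only [inner_sub_left, inner_sub_right] at *
      linarith
    have h4 := real_inner_le_norm (x - y) (π x - π y)
    rw [dist_eq_norm, dist_eq_norm, NNReal.coe_one, one_mul]
    by_contra! hlt
    nlinarith [norm_nonneg (x - y)]
  · have h1 := hin x x hx
    rw [real_inner_self_eq_norm_sq] at h1
    have h2 : ‖x - π x‖ = 0 := by nlinarith [norm_nonneg (x - π x)]
    exact (sub_eq_zero.1 (norm_eq_zero.1 h2)).symm

end Inner

/-- **Brouwer's fixed point theorem** for compact convex sets of a finite-dimensional normed
space. -/
theorem exists_fixedPoint_of_isCompact_of_convex {E : Type*} [NormedAddCommGroup E]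
    [NormedSpace ℝ E] [FiniteDimensional ℝ E] {K : Set E} (hne : K.Nonempty) (hK : IsCompact K)
    (hc : Convex ℝ K) {f : E → E} (hf : ContinuousOn f K) (hfK : MapsTo f K K) :
    ∃ x ∈ K, f x = x := by
  let e := toEuclidean (E := E)
  have hK' : IsCompact (e '' K) := hK.image e.continuous
  obtain ⟨π, hπ, hπK, hπfix⟩ := exists_lipschitzWith_retraction_of_convex (hne.image e)
    hK'.isClosed (hc.is_linear_image e.toLinearEquiv.toLinearMap.isLinear)
  have hsymm : ∀ y, e.symm (π y) ∈ K := by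
    intro y
    obtain ⟨x, hx, hxy⟩ := hπK y
    rw [← hxy]; simpa using hx
  obtain ⟨R, hR0, hR⟩ := hK'.isBounded.exists_pos_norm_le
  -- the map is transported to Euclidean space, precomposed with the projection, and rescaled so
  -- that its values lie in the unit ball
  have hcont : Continuous fun y => R⁻¹ • e (f (e.symm (π (R • y)))) := by
    refine (e.continuous.comp (hf.comp_continuous ?_ fun y => hsymm _)).const_smul R⁻¹
    exact e.symm.continuous.comp (hπ.continuous.comp (continuous_const_smul R))
  obtain ⟨y, hy⟩ := exists_fixedPoint_of_continuous_of_norm_le_one hcont fun y => by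
    rw [norm_smul, norm_inv, Real.norm_of_nonneg hR0.le, inv_mul_le_one₀ hR0]
    exact hR _ ⟨_, hfK (hsymm _), rfl⟩
  have h1 : e (f (e.symm (π (R • y)))) = R • y := by
    conv_rhs => rw [← hy]
    rw [smul_inv_smul₀ hR0.ne']
  have h2 : R • y ∈ e '' K := h1 ▸ ⟨_, hfK (hsymm _), rfl⟩
  rw [hπfix _ h2] at h1
  refine ⟨e.symm (R • y), ?_, ?_⟩
  · have := hsymm (R • y)
    rwa [hπfix _ h2] at this
  · exact e.injective (by rw [h1, e.apply_symm_apply])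

/-! ### Invariant measures of positive stochastic matrices -/

section Markov

variable {n : ℕ}

/-- A positive stochastic matrix has at most one invariant measure. The positive part of the
difference of two of them is again invariant, so by positivity of the entries it vanishes or is
positive everywhere; the latter is impossible, since the difference has sum zero. -/
theorem IsInvariantMeasure.eq_of_pos {A : Matrix (Fin n) (Fin n) ℝ} (hpos : ∀ i j, 0 < A i j)
    (hsum : ∀ i, ∑ j, A i j = 1) {u v : Fin n → ℝ} (hu : IsInvariantMeasure A u)
    (hv : IsInvariantMeasure A v) : u = v := by
  set w : Fin n → ℝ := u - v with hw
  have hwA : ∀ j, ∑ i, w i * A i j = w j := by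
    intro j
    have h1 : w ᵥ* A = w := by rw [hw, Matrix.sub_vecMul, hu.2, hv.2]
    exact congrFun h1 j
  have hwsum : ∑ j, w j = 0 := by
    simp [hw, Finset.sum_sub_distrib, hu.1.2, hv.1.2]
  have hle : ∀ j, max (w j) 0 ≤ ∑ i, max (w i) 0 * A i j := by
    intro j
    refine max_le ?_ (Finset.sum_nonneg fun i _ => mul_nonneg (le_max_right _ _) (hpos i j).le)
    rw [← hwA j]
    exact Finset.sum_le_sum fun i _ =>
      mul_le_mul_of_nonneg_right (le_max_left _ _) (hpos i j).le
  have htot : ∑ j, (∑ i, max (w i) 0 * A i j - max (w j) 0) = 0 := by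
    rw [Finset.sum_sub_distrib, Finset.sum_comm]
    simp [← Finset.mul_sum, hsum]
  have heq : ∀ j, ∑ i, max (w i) 0 * A i j = max (w j) 0 := fun j =>
    sub_eq_zero.1 ((Finset.sum_eq_zero_iff_of_nonneg fun j _ => sub_nonneg.2 (hle j)).1 htot j
      (Finset.mem_univ j))
  have hnonpos : ∀ i, w i ≤ 0 := by
    by_contra! h
    obtain ⟨i, hi⟩ := h
    have hall : ∀ j, 0 < w j := by
      intro j
      have h1 : 0 < max (w j) 0 := by
        rw [← heq j]
        exact Finset.sum_pos' (fun k _ => mul_nonneg (le_max_right _ _) (hpos k j).le)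
          ⟨i, Finset.mem_univ i, mul_pos (lt_max_of_lt_left hi) (hpos i j)⟩
      exact (lt_max_iff.1 h1).resolve_right (lt_irrefl 0)
    exact (Finset.sum_pos (fun j _ => hall j) ⟨i, Finset.mem_univ i⟩).ne' hwsum
  have hzero : ∀ i, w i = 0 := fun i =>
    (Finset.sum_eq_zero_iff_of_nonpos fun j _ => hnonpos j).1 hwsum i (Finset.mem_univ i)
  exact sub_eq_zero.1 (funext hzero)

theorem invariantMeasure_eq_of_pos {A : Matrix (Fin n) (Fin n) ℝ} (hpos : ∀ i j, 0 < A i j)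
    (hsum : ∀ i, ∑ j, A i j = 1) {u : Fin n → ℝ} (hu : IsInvariantMeasure A u) :
    invariantMeasure A = u := by
  have h : ∃! u, IsInvariantMeasure A u := ⟨u, hu, fun v hv => hv.eq_of_pos hpos hsum hu⟩
  rw [invariantMeasure, dif_pos h]
  exact h.choose_spec.1.eq_of_pos hpos hsum hu

end Markov

/-! ### Growth of a temperature family -/

section Temperature

variable {g : ℝ → ℝ → ℝ} {T : ℝ}

theorem IsTemperatureFamily.lipMin_le (hg : IsTemperatureFamily g) (hT : 0 < T) {x : ℝ}
    (hx : x ∈ Icc (0 : ℝ) 1) : lipMin (g T) ≤ derivWithin (g T) (Icc 0 1) x / g T x := by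
  refine csInf_le ⟨0, ?_⟩ (mem_image_of_mem _ hx)
  rintro _ ⟨y, hy, rfl⟩
  exact (div_pos (hg.deriv_pos T hT y hy) (hg.pos T hT y hy)).le

theorem IsTemperatureFamily.lipMin_nonneg (hg : IsTemperatureFamily g) (hT : 0 < T) :
    0 ≤ lipMin (g T) := by
  refine le_csInf ((nonempty_Icc.2 zero_le_one).image _) ?_
  rintro _ ⟨y, hy, rfl⟩
  exact (div_pos (hg.deriv_pos T hT y hy) (hg.pos T hT y hy)).le

/-- The logarithm of `g T` has slope at least `lipMin (g T)` on `[0, 1]`. -/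
theorem IsTemperatureFamily.le_mul_exp (hg : IsTemperatureFamily g) (hT : 0 < T) {a b : ℝ}
    (ha : a ∈ Icc (0 : ℝ) 1) (hb : b ∈ Icc (0 : ℝ) 1) (hab : a ≤ b) :
    g T a ≤ g T b * Real.exp (-(lipMin (g T) * (b - a))) := by
  have hdiff : DifferentiableOn ℝ (g T) (Icc 0 1) :=
    (hg.contDiffOn T hT).differentiableOn one_ne_zero
  have hlog : lipMin (g T) * (b - a) ≤ Real.log (g T b) - Real.log (g T a) := by
    refine (convex_Icc (0 : ℝ) 1).mul_sub_le_image_sub_of_le_deriv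
      (f := fun x => Real.log (g T x))
      (hdiff.continuousOn.log fun x hx => (hg.pos T hT x hx).ne')
      ((hdiff.log fun x hx => (hg.pos T hT x hx).ne').mono interior_subset)
      (fun x hx => ?_) a ha b hb hab
    have hx' : x ∈ Icc (0 : ℝ) 1 := interior_subset hx
    have hnhds : Icc (0 : ℝ) 1 ∈ 𝓝 x := mem_interior_iff_mem_nhds.1 hx
    rw [deriv.log (hdiff.differentiableAt hnhds) (hg.pos T hT x hx').ne',
      ← derivWithin_of_mem_nhds hnhds]
    exact hg.lipMin_le hT hx'
  have hga := hg.pos T hT a ha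
  have hgb := hg.pos T hT b hb
  calc g T a = Real.exp (Real.log (g T a)) := (Real.exp_log hga).symm
    _ ≤ Real.exp (Real.log (g T b) + -(lipMin (g T) * (b - a))) :=
        Real.exp_le_exp.2 (by linarith)
    _ = _ := by rw [Real.exp_add, Real.exp_log hgb]

end Temperature

/-! ### Fixed points near the vertices -/

section Transition

variable {n : ℕ} {C : Matrix (Fin n) (Fin n) ℝ} {g : ℝ → ℝ → ℝ} {T : ℝ} {x : Fin n → ℝ}

theorem IsTemperatureFamily.sum_mul_pos (hC : ∀ i j, 0 < C i j) (hg : IsTemperatureFamily g)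
    (hT : 0 < T) (hx : x ∈ stdSimplex ℝ (Fin n)) (i : Fin n) :
    0 < ∑ k, C i k * g T (x k) :=
  Finset.sum_pos (fun k _ => mul_pos (hC i k) (hg.pos T hT _ (mem_Icc_of_mem_stdSimplex hx k)))
    ⟨i, Finset.mem_univ i⟩

theorem transitionMatrix_pos (hC : ∀ i j, 0 < C i j) (hg : IsTemperatureFamily g) (hT : 0 < T)
    (hx : x ∈ stdSimplex ℝ (Fin n)) (i j : Fin n) : 0 < transitionMatrix C g T x i j :=
  div_pos (mul_pos (hC i j) (hg.pos T hT _ (mem_Icc_of_mem_stdSimplex hx j)))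
    (hg.sum_mul_pos hC hT hx i)

theorem sum_transitionMatrix (hC : ∀ i j, 0 < C i j) (hg : IsTemperatureFamily g) (hT : 0 < T)
    (hx : x ∈ stdSimplex ℝ (Fin n)) (i : Fin n) : ∑ j, transitionMatrix C g T x i j = 1 := by
  simp only [transitionMatrix, Matrix.of_apply]
  rw [← Finset.sum_div, div_self (hg.sum_mul_pos hC hT hx i).ne']

/-- Solutions of `x M_T(x) = x` in the simplex are fixed points of `u_T`. -/
theorem isFixedPt_uMap_of_vecMul_eq (hC : ∀ i j, 0 < C i j) (hg : IsTemperatureFamily g)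
    (hT : 0 < T) (hx : x ∈ stdSimplex ℝ (Fin n)) (h : x ᵥ* transitionMatrix C g T x = x) :
    Function.IsFixedPt (uMap C g T) x :=
  invariantMeasure_eq_of_pos (transitionMatrix_pos hC hg hT hx)
    (sum_transitionMatrix hC hg hT hx) ⟨hx, h⟩

theorem continuousOn_vecMul_transitionMatrix (hC : ∀ i j, 0 < C i j)
    (hg : IsTemperatureFamily g) (hT : 0 < T) :
    ContinuousOn (fun x => x ᵥ* transitionMatrix C g T x) (stdSimplex ℝ (Fin n)) := by
  have hgc : ∀ k, ContinuousOn (fun x : Fin n → ℝ => g T (x k)) (stdSimplex ℝ (Fin n)) := fun k =>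
    (hg.contDiffOn T hT).continuousOn.comp (continuous_apply k).continuousOn
      fun x hx => mem_Icc_of_mem_stdSimplex hx k
  refine continuousOn_pi.2 fun j => ?_
  simp only [Matrix.vecMul, dotProduct, transitionMatrix, Matrix.of_apply]
  refine continuousOn_finsetSum _ fun i _ => (continuous_apply i).continuousOn.mul ?_
  refine (continuousOn_const.mul (hgc j)).div
    (continuousOn_finsetSum _ fun k _ => continuousOn_const.mul (hgc k)) fun x hx => ?_
  exact (hg.sum_mul_pos hC hT hx i).ne'

theorem vecMul_transitionMatrix_mem_stdSimplex (hC : ∀ i j, 0 < C i j)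
    (hg : IsTemperatureFamily g) (hT : 0 < T) (hx : x ∈ stdSimplex ℝ (Fin n)) :
    x ᵥ* transitionMatrix C g T x ∈ stdSimplex ℝ (Fin n) := by
  simp only [stdSimplex, mem_ofPred_eq, Matrix.vecMul, dotProduct]
  refine ⟨fun j => Finset.sum_nonneg fun i _ =>
    mul_nonneg (hx.1 i) (transitionMatrix_pos hC hg hT hx i j).le, ?_⟩
  rw [Finset.sum_comm]
  simp_rw [← Finset.mul_sum, sum_transitionMatrix hC hg hT hx, mul_one, hx.2]

/-- If `x` puts mass at least `1 - ε` on `r`, then every row of `M_T(x)` does so too, provided that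
`lipMin (g T)` is large: for `k ≠ r` the ratio `g T (x k) / g T (x r)` is at most
`exp (-(lipMin (g T) * (1 - 2 * ε)))`. -/
theorem one_sub_le_transitionMatrix (hC : ∀ i j, 0 < C i j) (hg : IsTemperatureFamily g)
    (hT : 0 < T) {κ ε : ℝ} (hκ : ∀ i r, ∑ k, C i k ≤ κ * C i r) (hε0 : 0 < ε) (hε : ε < 1 / 2)
    (hκε : κ * Real.exp (-(lipMin (g T) * (1 - 2 * ε))) ≤ ε)
    (hx : x ∈ stdSimplex ℝ (Fin n)) {r : Fin n} (hxr : 1 - ε ≤ x r) (i : Fin n) :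
    1 - ε ≤ transitionMatrix C g T x i r := by
  set q := Real.exp (-(lipMin (g T) * (1 - 2 * ε))) with hq
  have hgr := hg.pos T hT _ (mem_Icc_of_mem_stdSimplex hx r)
  have hgk : ∀ k, k ≠ r → g T (x k) ≤ g T (x r) * q := by
    intro k hk
    have hkr : x k + x r ≤ 1 := by
      rw [← hx.2, ← Finset.sum_pair hk]
      exact Finset.sum_le_sum_of_subset_of_nonneg (Finset.subset_univ _) fun j _ _ => hx.1 j
    refine (hg.le_mul_exp hT (mem_Icc_of_mem_stdSimplex hx k) (mem_Icc_of_mem_stdSimplex hx r)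
      (by linarith)).trans ?_
    refine mul_le_mul_of_nonneg_left (Real.exp_le_exp.2 (neg_le_neg ?_)) hgr.le
    exact mul_le_mul_of_nonneg_left (by linarith) (hg.lipMin_nonneg hT)
  have hsum : ∑ k, C i k * g T (x k) ≤ (1 + ε) * (C i r * g T (x r)) := by
    rw [← Finset.add_sum_erase _ _ (Finset.mem_univ r)]
    have h1 : ∑ k ∈ Finset.univ.erase r, C i k * g T (x k)
        ≤ ∑ k ∈ Finset.univ.erase r, C i k * (g T (x r) * q) :=
      Finset.sum_le_sum fun k hk =>
        mul_le_mul_of_nonneg_left (hgk k (Finset.ne_of_mem_erase hk)) (hC i k).le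
    have h2 : ∑ k ∈ Finset.univ.erase r, C i k * (g T (x r) * q)
        ≤ ∑ k, C i k * (g T (x r) * q) :=
      Finset.sum_le_sum_of_subset_of_nonneg (Finset.erase_subset _ _) fun k _ _ =>
        mul_nonneg (hC i k).le (mul_nonneg hgr.le (Real.exp_nonneg _))
    rw [← Finset.sum_mul (s := Finset.univ)] at h2
    have h3 : (∑ k, C i k) * (g T (x r) * q) ≤ κ * C i r * (g T (x r) * q) :=
      mul_le_mul_of_nonneg_right (hκ i r) (mul_nonneg hgr.le (Real.exp_nonneg _))
    have h4 : (κ * q) * (C i r * g T (x r)) ≤ ε * (C i r * g T (x r)) :=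
      mul_le_mul_of_nonneg_right hκε (mul_pos (hC i r) hgr).le
    linarith
  simp only [transitionMatrix, Matrix.of_apply]
  rw [le_div_iff₀ (hg.sum_mul_pos hC hT hx i)]
  have h5 := mul_pos (hC i r) hgr
  -- `(1 - ε) * (1 + ε) ≤ 1`
  nlinarith [mul_pos (mul_pos hε0 hε0) h5]

/-- The map `x ↦ x M_T(x)` preserves the part of the simplex where `1 - ε ≤ x r`, which is compact
and convex, so Brouwer's theorem applies to it. -/
theorem exists_isFixedPt_uMap_near_vertex (hC : ∀ i j, 0 < C i j) (hg : IsTemperatureFamily g)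
    (hT : 0 < T) {κ ε : ℝ} (hκ : ∀ i r, ∑ k, C i k ≤ κ * C i r) (hε0 : 0 < ε) (hε : ε < 1 / 2)
    (hκε : κ * Real.exp (-(lipMin (g T) * (1 - 2 * ε))) ≤ ε) (r : Fin n) :
    ∃ x ∈ stdSimplex ℝ (Fin n), Function.IsFixedPt (uMap C g T) x ∧ 1 - ε ≤ x r := by
  let K : Set (Fin n → ℝ) := stdSimplex ℝ (Fin n) ∩ {x | 1 - ε ≤ x r}
  have hne : K.Nonempty := ⟨Pi.single r 1, single_mem_stdSimplex ℝ r, by simp [hε0.le]⟩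
  have hK : IsCompact K := (isCompact_stdSimplex ℝ (Fin n)).inter_right
    (isClosed_le continuous_const (continuous_apply r))
  have hc : Convex ℝ K := (convex_stdSimplex ℝ (Fin n)).inter
    (convex_halfSpace_ge (LinearMap.proj r : (Fin n → ℝ) →ₗ[ℝ] ℝ).isLinear _)
  obtain ⟨x, hx, hfix⟩ := exists_fixedPoint_of_isCompact_of_convex hne hK hc
    ((continuousOn_vecMul_transitionMatrix hC hg hT).mono inter_subset_left) fun x hx =>
      ⟨vecMul_transitionMatrix_mem_stdSimplex hC hg hT hx.1, by
        have h1 : ∑ i, x i * (1 - ε) ≤ ∑ i, x i * transitionMatrix C g T x i r :=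
          Finset.sum_le_sum fun i _ => mul_le_mul_of_nonneg_left
            (one_sub_le_transitionMatrix hC hg hT hκ hε0 hε hκε hx.1 hx.2 i) (hx.1.1 i)
        rwa [← Finset.sum_mul, hx.1.2, one_mul] at h1⟩
  exact ⟨x, hx.1, isFixedPt_uMap_of_vecMul_eq hC hg hT hx.1 hfix, hx.2⟩

theorem exists_forall_sum_le_mul (hC : ∀ i j, 0 < C i j) :
    ∃ κ, ∀ i r, ∑ k, C i k ≤ κ * C i r := by
  obtain ⟨κ, hκ⟩ := (finite_range fun p : Fin n × Fin n =>
    (∑ k, C p.1 k) / C p.1 p.2).bddAbove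
  exact ⟨κ, fun i r => (div_le_iff₀ (hC i r)).1 (hκ ⟨(i, r), rfl⟩)⟩

end Transition

theorem mainTheorem4 (n : ℕ) (hn : 2 ≤ n) (C : Matrix (Fin n) (Fin n) ℝ)
    (hC : ∀ i j, 0 < C i j) (g : ℝ → ℝ → ℝ) (hg : IsTemperatureFamily g) :
    (∃ T₀ > 0, ∀ T, 0 < T → T ≤ T₀ →
      {x ∈ stdSimplex ℝ (Fin n) | Function.IsFixedPt (uMap C g T) x}.Nontrivial) ∧
    (∀ ε : ℝ, 0 < ε → ε < 1 / 2 → ∃ T₀ > 0, ∀ T, 0 < T → T ≤ T₀ →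
      ∀ r : Fin n, ∃ x ∈ stdSimplex ℝ (Fin n),
        Function.IsFixedPt (uMap C g T) x ∧ 1 - ε ≤ x r) := by
  obtain ⟨κ, hκ⟩ := exists_forall_sum_le_mul hC
  have hvertex : ∀ ε : ℝ, 0 < ε → ε < 1 / 2 → ∃ T₀ > 0, ∀ T, 0 < T → T ≤ T₀ →
      ∀ r : Fin n, ∃ x ∈ stdSimplex ℝ (Fin n),
        Function.IsFixedPt (uMap C g T) x ∧ 1 - ε ≤ x r := by
    intro ε hε0 hε
    have hlim : Tendsto (fun T => κ * Real.exp (-(lipMin (g T) * (1 - 2 * ε)))) (𝓝[>] 0)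
        (𝓝 (κ * 0)) :=
      (Real.tendsto_exp_neg_atTop_nhds_zero.comp
        (hg.tendsto_lipMin.atTop_mul_const (by linarith))).const_mul κ
    rw [mul_zero] at hlim
    obtain ⟨T₀, hT₀, hsub⟩ := mem_nhdsGT_iff_exists_Ioc_subset.1
      (hlim.eventually (eventually_le_nhds hε0))
    exact ⟨T₀, hT₀, fun T hT hTT₀ =>
      exists_isFixedPt_uMap_near_vertex hC hg hT hκ hε0 hε (hsub ⟨hT, hTT₀⟩)⟩
  refine ⟨?_, hvertex⟩
  -- any `ε < 1 / 2` separates the fixed points belonging to two different vertices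
  obtain ⟨T₀, hT₀, h⟩ := hvertex (1 / 4) (by norm_num) (by norm_num)
  refine ⟨T₀, hT₀, fun T hT hTT₀ => ?_⟩
  obtain ⟨x, hx, hxfix, hx0⟩ := h T hT hTT₀ ⟨0, by omega⟩
  obtain ⟨y, hy, hyfix, hy1⟩ := h T hT hTT₀ ⟨1, by omega⟩
  refine ⟨x, ⟨hx, hxfix⟩, y, ⟨hy, hyfix⟩, ?_⟩
  rintro rfl
  have h01 : (⟨0, by omega⟩ : Fin n) ≠ ⟨1, by omega⟩ := by simp
  have hle : x ⟨0, by omega⟩ + x ⟨1, by omega⟩ ≤ 1 := by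
    rw [← hx.2, ← Finset.sum_pair h01]
    exact Finset.sum_le_sum_of_subset_of_nonneg (Finset.subset_univ _) fun j _ _ => hx.1 j
  linarith
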